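/- Let $G$ be a discrete group. For $a=\sum_g a_g g$ in the group algebra $\mathbb{C}G$ and a unitary representation $\pi$ of $G$ on a complex Hilbert space, write $\pi(a)=\sum_g a_g\pi(g)$. Let $\|a\|=\sup_\pi\|\pi(a)\|$, the supremum over all unitary representations of $G$ on Hilbert spaces (this is the norm of $a$ in the full group $C^*$-algebra $C^*(G)$), and for $n\in\mathbb{N}$ let $\|a\|_{\mathbb{M}_n}=\sup\|\pi(a)\|$, the supremum over all unitary representations $\pi$ of $G$ of dimension at most $n$ (operator norms throughout). Let $n_1<n_2<\infty$ be natural numbers such that $G$ has an irreducible unitary representation of dimension $n_2$. Then for every $\varepsilon>0$ there is an $a\in\mathbb{C}G$ with $$\|a\|=1,\qquad \|a\|_{\mathbb{M}_{n_1}}\le\varepsilon\qquad\text{and}\qquad \|a\|_{\mathbb{M}_{n_2}}>\|a\|-\varepsilon .$$ -/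

import Mathlib

universe u v

/-- A unitary representation of a (discrete) group `G` on a complex Hilbert space `H`. -/
abbrev UnitaryRep (G : Type u) [Group G] (H : Type v) [NormedAddCommGroup H]
    [InnerProductSpace ℂ H] [CompleteSpace H] : Type (max u v) :=
  G →* unitary (H →L[ℂ] H)

namespace UnitaryRep

section

variable {G : Type u} [Group G] {H : Type v} [NormedAddCommGroup H]
  [InnerProductSpace ℂ H] [CompleteSpace H]

/-- The linear extension of a unitary representation of `G` to the group algebra `ℂG`. -/
noncomputable def extend (π : UnitaryRep G H) : MonoidAlgebra ℂ G →ₐ[ℂ] (H →L[ℂ] H) :=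
  MonoidAlgebra.lift ℂ (H →L[ℂ] H) G ((unitary (H →L[ℂ] H)).subtype.comp π)

/-- A unitary representation is irreducible if its space is nonzero and has no closed invariant
subspace other than `0` and the whole space. -/
def IsIrreducible (π : UnitaryRep G H) : Prop :=
  Nontrivial H ∧ ∀ W : Submodule ℂ H, IsClosed (W : Set H) →
    (∀ g : G, ∀ w ∈ W, (π g : H →L[ℂ] H) w ∈ W) → W = ⊥ ∨ W = ⊤

/-- Every unitary representation is bounded by the `ℓ¹`-norm, so that the suprema below are
suprema of bounded sets. -/
theorem norm_extend_le (π : UnitaryRep G H) (a : MonoidAlgebra ℂ G) :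
    ‖π.extend a‖ ≤ a.coeff.sum fun _ z => ‖z‖ := by
  have h1 : ∀ U : unitary (H →L[ℂ] H), ‖(U : H →L[ℂ] H)‖ ≤ 1 := by
    intro U
    rcases subsingleton_or_nontrivial H with hH | hH
    · have : (U : H →L[ℂ] H) = 0 := by
        ext x
        exact Subsingleton.elim _ _
      simp [this]
    · exact (CStarRing.norm_coe_unitary U).le
  rw [extend, MonoidAlgebra.lift_apply]
  refine (norm_sum_le _ _).trans (Finset.sum_le_sum fun g _ => ?_)
  rw [norm_smul]
  exact mul_le_of_le_one_right (norm_nonneg _) (h1 (π g))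

end

end UnitaryRep

/-- The norm `‖a‖` of the full group C⋆-algebra `C⋆(G)` on the group algebra `ℂG`: the supremum of
`‖π(a)‖` over all unitary representations `π` of `G` on Hilbert spaces. (Hilbert spaces in the
universe of `G` suffice, since `‖π(a)‖` is determined by the cyclic subrepresentations of `π`.) -/
noncomputable def fullGroupNorm {G : Type u} [Group G] (a : MonoidAlgebra ℂ G) : ℝ :=
  sSup {r : ℝ | ∃ (H : Type u) (_ : NormedAddCommGroup H) (_ : InnerProductSpace ℂ H)
    (_ : CompleteSpace H) (π : UnitaryRep G H), r = ‖π.extend a‖}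

/-- The seminorm `‖a‖_{𝕄ₙ}` on `ℂG`: the supremum of `‖π(a)‖` over all unitary representations
`π` of `G` of dimension not larger than `n`. The norm is the operator norm on `ℂᵏ`.
(A possibly degenerate representation of `C⋆(G)` on `ℂⁿ` is a unitary representation of `G` on
a subspace, plus zero.) -/
noncomputable def matrixSeminorm {G : Type u} [Group G] (n : ℕ) (a : MonoidAlgebra ℂ G) : ℝ :=
  sSup {r : ℝ | ∃ k : ℕ, k ≤ n ∧ ∃ π : UnitaryRep G (EuclideanSpace ℂ (Fin k)),
    r = ‖π.extend a‖}

theorem fullGroupNorm_bddAbove {G : Type u} [Group G] (a : MonoidAlgebra ℂ G) :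
    BddAbove {r : ℝ | ∃ (H : Type u) (_ : NormedAddCommGroup H) (_ : InnerProductSpace ℂ H)
      (_ : CompleteSpace H) (π : UnitaryRep G H), r = ‖π.extend a‖} := by
  refine ⟨a.coeff.sum fun _ z => ‖z‖, ?_⟩
  rintro r ⟨H, _, _, _, π, rfl⟩
  exact π.norm_extend_le a

theorem matrixSeminorm_bddAbove {G : Type u} [Group G] (n : ℕ) (a : MonoidAlgebra ℂ G) :
    BddAbove {r : ℝ | ∃ k : ℕ, k ≤ n ∧ ∃ π : UnitaryRep G (EuclideanSpace ℂ (Fin k)),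
      r = ‖π.extend a‖} := by
  refine ⟨a.coeff.sum fun _ z => ‖z‖, ?_⟩
  rintro r ⟨k, _, π, rfl⟩
  exact π.norm_extend_le a

/-! A Capelli polynomial in `n₁ ^ 2 + 1` alternating variables vanishes on all `k × k` matrices with
`k ≤ n₁`, but not on `n₂ × n₂` matrices. By Burnside's theorem the irreducible `π` maps `ℂG` onto
the latter, so lifting suitable matrices gives `c` with `π(c) ≠ 0` that every representation of
dimension at most `n₁` kills. Scale `c⋆c` to a self-adjoint `b` with `‖π(b)‖ = 1`. Other
representations may make `b` large, but never beyond its `ℓ¹`-norm `R`. A real polynomial `p` with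
`p(0) = 0`, `|p| ≤ 1` on `[-R, R]` and `|p(±1)| = 1` then flattens it: `a = p(b)` has norm `1`,
attained at `π`, and still dies in dimension at most `n₁`. -/

open Polynomial

/-! ### Capelli polynomials -/

/-- The Capelli polynomial `∑ σ, sign σ • ∏ i, y i * x (σ i) * z i` in an algebra `A`, the product
being taken in the order of `Fin m`. -/
noncomputable def capelli {A : Type*} [Ring A] {m : ℕ} (y x z : Fin m → A) : A :=
  ∑ σ : Equiv.Perm (Fin m),
    Equiv.Perm.sign σ • (List.ofFn fun i => y i * x (σ i) * z i).prod

theorem map_capelli {A B F : Type*} [Ring A] [Ring B] [FunLike F A B] [RingHomClass F A B]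
    (f : F) {m : ℕ} (y x z : Fin m → A) :
    f (capelli y x z) = capelli (f ∘ y) (f ∘ x) (f ∘ z) := by
  simp only [capelli, map_sum, Units.smul_def, map_zsmul, map_list_prod, List.map_ofFn]
  simp [Function.comp_def]

/-- The Capelli polynomial in `m` alternating variables vanishes on algebras of dimension less
than `m`. -/
theorem capelli_eq_zero_of_finrank_lt {K A : Type*} [Field K] [Ring A] [Algebra K A]
    [FiniteDimensional K A] {m : ℕ} (hm : Module.finrank K A < m) (y x z : Fin m → A) :
    capelli y x z = 0 := by
  let f : MultilinearMap K (fun _ : Fin m => A) A :=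
    (MultilinearMap.mkPiAlgebraFin K m A).compLinearMap
      fun i => LinearMap.mulLeftRight K (y i, z i)
  -- With `y` and `z` fixed, the Capelli polynomial is the alternatization of `f`, so it vanishes on
  -- dependent families.
  have h := (MultilinearMap.alternatization f).map_linearDependent x fun hx => by
    have := hx.fintype_card_le_finrank
    simp at this
    omega
  rw [MultilinearMap.alternatization_apply] at h
  simpa [capelli, f] using h

/-- On `n × n` matrices the Capelli polynomial in at most `n ^ 2` alternating variables takes
nonzero values. -/
theorem exists_capelli_matrix_ne_zero (K : Type*) [Field K] {m n : ℕ} (hm : m ≤ n * n)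
    (hn : 0 < n) : ∃ y x z : Fin m → Matrix (Fin n) (Fin n) K, capelli y x z ≠ 0 := by
  let o : Fin n := ⟨0, hn⟩
  let e : Fin m → Fin n × Fin n := fun i => finProdFinEquiv.symm (Fin.castLE hm i)
  have he : Function.Injective e :=
    finProdFinEquiv.symm.injective.comp (Fin.castLE_injective hm)
  -- Bordering by matrix units detects `j = i`, so only the identity permutation contributes.
  have key : ∀ i j, Matrix.single o (e i).1 (1 : K) * Matrix.single (e j).1 (e j).2 1 *
      Matrix.single (e i).2 o 1 = if j = i then Matrix.single o o 1 else 0 := by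
    intro i j
    split_ifs with h
    · subst h; simp
    · by_cases h1 : (e i).1 = (e j).1
      · have h2 : (e j).2 ≠ (e i).2 := fun h2 => h (he (Prod.ext h1.symm h2))
        rw [h1, Matrix.single_mul_single_same, Matrix.single_mul_single_of_ne _ _ _ _ h2]
      · rw [Matrix.single_mul_single_of_ne _ _ _ _ h1, zero_mul]
  refine ⟨fun i => Matrix.single o (e i).1 1, fun i => Matrix.single (e i).1 (e i).2 1,
    fun i => Matrix.single (e i).2 o 1, ?_⟩
  rw [capelli, Finset.sum_eq_single 1]
  · simp only [key, Equiv.Perm.sign_one, Equiv.Perm.one_apply, if_true, one_smul, List.ofFn_const,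
      List.prod_replicate]
    have hidem : IsIdempotentElem (Matrix.single o o (1 : K)) := by
      simp [IsIdempotentElem]
    rcases Nat.eq_zero_or_pos m with h0 | h0
    · subst h0
      have : Nonempty (Fin n) := ⟨o⟩
      simp
    · obtain ⟨k, rfl⟩ := Nat.exists_eq_succ_of_ne_zero h0.ne'
      rw [hidem.pow_succ_eq]
      intro h
      simpa using congr_fun (congr_fun h o) o
  · intro σ _ hσ
    obtain ⟨i, hi⟩ : ∃ i, σ i ≠ i := by
      by_contra! h
      exact hσ (Equiv.ext h)
    rw [List.prod_eq_zero, smul_zero]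
    rw [List.mem_ofFn]
    exact ⟨i, by rw [key, if_neg hi]⟩
  · simp

/-! ### Burnside's theorem -/

/-- **Burnside's theorem**: an algebra of operators on a nonzero finite-dimensional complex space
without nontrivial invariant subspaces consists of all operators. -/
theorem surjective_of_forall_invariant_eq_bot_or_top {A H : Type*} [Ring A] [Algebra ℂ A]
    [NormedAddCommGroup H] [NormedSpace ℂ H] [FiniteDimensional ℂ H] [Nontrivial H]
    (φ : A →ₐ[ℂ] (H →L[ℂ] H))
    (hφ : ∀ W : Submodule ℂ H, (∀ a, ∀ w ∈ W, φ a w ∈ W) → W = ⊥ ∨ W = ⊤) :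
    Function.Surjective φ := by
  let : Module A H := Module.compHom H φ.toRingHom
  have smul_def : ∀ (a : A) (x : H), a • x = φ a x := fun _ _ => rfl
  have : IsScalarTower ℂ A H := ⟨fun c a x => by simp [smul_def]⟩
  have : IsSimpleModule A H := by
    refine (isSimpleModule_iff A H).2 ⟨fun W => ?_⟩
    rcases hφ (W.restrictScalars ℂ) fun a w hw => W.smul_mem a hw with h | h
    · exact .inl ((Submodule.restrictScalars_eq_bot_iff ℂ A H).1 h)
    · exact .inr ((Submodule.restrictScalars_eq_top_iff ℂ A H).1 h)
  intro T
  -- By Schur's lemma the commutant is `ℂ`, so `T` commutes with it and the density theorem applies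
  -- on a finite spanning set.
  let f : Module.End (Module.End A H) H :=
    { toFun := T
      map_add' := T.map_add
      map_smul' := fun s x => by
        obtain ⟨c, rfl⟩ := (IsSimpleModule.algebraMap_end_bijective_of_isAlgClosed
          (A := A) (V := H) ℂ).2 s
        simp }
  obtain ⟨s, hs⟩ := Module.Finite.fg_top (R := ℂ) (M := H)
  obtain ⟨a, ha⟩ := jacobson_density f s
  refine ⟨a, ?_⟩
  have : (φ a : H →ₗ[ℂ] H) = T := by
    refine LinearMap.ext_on hs fun x hx => ?_
    exact (ha x hx).symm
  exact ContinuousLinearMap.coe_injective this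

/-! ### Chebyshev polynomials and functional calculus -/

/-- For `R` there is a real polynomial without constant term which is bounded by `1` on `[-R, R]`
and has modulus `1` at `±1`: a rescaled Chebyshev polynomial. -/
theorem exists_polynomial_bounded_by_one (R : ℝ) :
    ∃ p : ℝ[X], p.eval 0 = 0 ∧ (∀ x, |x| ≤ R → |p.eval x| ≤ 1) ∧
      |p.eval 1| = 1 ∧ |p.eval (-1)| = 1 := by
  obtain ⟨k, hk⟩ := exists_nat_ge (max R 0 * Real.pi)
  -- Oddness gives `T_n(0) = 0`; `n ≡ 1 mod 4` gives `T_n(s) = cos(2πk) = 1`; the size of `k` gives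
  -- `s * R ≤ 1`.
  set n : ℤ := 4 * k + 1 with hn
  have hodd : Odd n := ⟨2 * k, by rw [hn]; ring⟩
  have hnR : (n : ℝ) = 4 * k + 1 := by rw [hn]; push_cast; ring
  have hn0 : (0 : ℝ) < n := by rw [hnR]; positivity
  set s : ℝ := Real.sin (Real.pi / (2 * n)) with hs
  have hs0 : 0 ≤ s := by
    refine Real.sin_nonneg_of_nonneg_of_le_pi (by positivity) ?_
    refine div_le_self Real.pi_pos.le ?_
    rw [hnR]; have : (0 : ℝ) ≤ k := k.cast_nonneg
    linarith
  have hone : (Chebyshev.T ℝ n).eval s = 1 := by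
    rw [hs, ← Real.cos_pi_div_two_sub, Chebyshev.T_real_cos]
    have : (n : ℝ) * (Real.pi / 2 - Real.pi / (2 * n)) = k * (2 * Real.pi) := by
      field_simp
      rw [hnR]; ring
    rw [this, Real.cos_nat_mul_two_pi]
  refine ⟨(Chebyshev.T ℝ n).comp (C s * X), ?_, fun x hx => ?_, ?_, ?_⟩
  · simp [Chebyshev.T_eval_zero_of_odd, hodd]
  · rw [eval_comp]
    refine Chebyshev.abs_eval_T_real_le_one n ?_
    simp only [eval_mul, eval_C, eval_X]
    rw [abs_mul, abs_of_nonneg hs0]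
    have h1 : s ≤ Real.pi / (2 * n) := Real.sin_le (by positivity)
    calc s * |x| ≤ Real.pi / (2 * n) * max R 0 := by
            gcongr
            exact hx.trans (le_max_left _ _)
      _ = (max R 0 * Real.pi) / (2 * n) := by ring
      _ ≤ 1 := by
        rw [div_le_one (by positivity), hnR]
        have : (0 : ℝ) ≤ k := k.cast_nonneg
        linarith
  · simp [hone]
  · simp [Chebyshev.T_eval_neg, hone, hodd]

theorem norm_aeval_le_of_isSelfAdjoint {H : Type*} [NormedAddCommGroup H]
    [InnerProductSpace ℂ H] [CompleteSpace H] {T : H →L[ℂ] H} (hT : IsSelfAdjoint T) (p : ℝ[X])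
    (hp : ∀ x, |x| ≤ ‖T‖ → |p.eval x| ≤ 1) : ‖aeval T p‖ ≤ 1 := by
  rcases subsingleton_or_nontrivial H with hH | hH
  · rw [Subsingleton.elim (aeval T p) 0, norm_zero]
    exact zero_le_one
  · rw [← cfc_polynomial p T]
    exact norm_cfc_le zero_le_one fun x hx => hp x (spectrum.norm_le_norm_of_mem hx)

/-- The spectrum of a self-adjoint `T` contains `‖T‖` or `-‖T‖`, hence the conditions at both `1`
and `-1`. -/
theorem one_le_norm_aeval_of_isSelfAdjoint {H : Type*} [NormedAddCommGroup H]
    [InnerProductSpace ℂ H] [CompleteSpace H] {T : H →L[ℂ] H} (hT : IsSelfAdjoint T)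
    (hT1 : ‖T‖ = 1) {p : ℝ[X]} (hp : |p.eval 1| = 1) (hp' : |p.eval (-1)| = 1) :
    1 ≤ ‖aeval T p‖ := by
  have : Nontrivial (H →L[ℂ] H) :=
    ⟨T, 0, fun h => by simp [h] at hT1⟩
  rw [← cfc_polynomial p T]
  rcases CStarAlgebra.norm_or_neg_norm_mem_spectrum hT with h | h
  · rw [hT1] at h
    exact hp.symm.le.trans (norm_apply_le_norm_cfc p.eval T h)
  · rw [hT1] at h
    exact hp'.symm.le.trans (norm_apply_le_norm_cfc p.eval T h)

/-! ### Representations of the group algebra -/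

namespace MonoidAlgebra

/-- The involution `∑ a_g g ↦ ∑ conj a_g g⁻¹` of the complex group algebra. -/
noncomputable def involution {G : Type*} [Group G] (a : MonoidAlgebra ℂ G) : MonoidAlgebra ℂ G :=
  a.coeff.sum fun g z => single g⁻¹ (star z)

end MonoidAlgebra

namespace UnitaryRep

variable {G : Type*} [Group G] {H : Type*} [NormedAddCommGroup H]
  [InnerProductSpace ℂ H] [CompleteSpace H]

theorem extend_single (π : UnitaryRep G H) (g : G) (z : ℂ) :
    π.extend (MonoidAlgebra.single g z) = z • (π g : H →L[ℂ] H) := by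
  simp [extend, MonoidAlgebra.lift_single]

theorem extend_involution (π : UnitaryRep G H) (a : MonoidAlgebra ℂ G) :
    π.extend a.involution = star (π.extend a) := by
  rw [MonoidAlgebra.involution, Finsupp.sum, map_sum]
  conv_rhs => rw [extend, MonoidAlgebra.lift_apply, Finsupp.sum, star_sum]
  refine Finset.sum_congr rfl fun g _ => ?_
  rw [extend_single, star_smul, map_inv, ← Unitary.star_eq_inv]
  rfl

theorem extend_aeval_map (π : UnitaryRep G H) (b : MonoidAlgebra ℂ G) (p : ℝ[X]) :
    π.extend (aeval b (p.map (algebraMap ℝ ℂ))) = aeval (π.extend b) p := by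
  rw [← aeval_algHom_apply, aeval_map_algebraMap]

theorem extend_surjective_of_isIrreducible [FiniteDimensional ℂ H] {π : UnitaryRep G H}
    (hπ : π.IsIrreducible) : Function.Surjective π.extend := by
  have := hπ.1
  refine surjective_of_forall_invariant_eq_bot_or_top _ fun W hW =>
    hπ.2 W W.closed_of_finiteDimensional fun g w hw => ?_
  simpa [extend_single] using hW (MonoidAlgebra.single g 1) w hw

/-- Transport of a unitary representation along an isometric isomorphism. -/
noncomputable def conj {K : Type*} [NormedAddCommGroup K] [InnerProductSpace ℂ K] [CompleteSpace K]
    (e : H ≃ₗᵢ[ℂ] K) (π : UnitaryRep G H) : UnitaryRep G K where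
  toFun g := ⟨e.conjStarAlgEquiv (π g), Unitary.map_mem e.conjStarAlgEquiv (π g).2⟩
  map_one' := Subtype.ext <| by simp
  map_mul' g h := Subtype.ext <| by simp

theorem norm_extend_conj {K : Type*} [NormedAddCommGroup K] [InnerProductSpace ℂ K]
    [CompleteSpace K] (e : H ≃ₗᵢ[ℂ] K) (π : UnitaryRep G H) (a : MonoidAlgebra ℂ G) :
    ‖(π.conj e).extend a‖ = ‖π.extend a‖ := by
  have h : (π.conj e).extend = e.conjStarAlgEquiv.toAlgEquiv.toAlgHom.comp π.extend := by
    refine MonoidAlgebra.algHom_ext (fun g => ?_) (Subsingleton.elim _ _)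
    simp [extend_single, conj]
  rw [h]
  exact StarAlgEquiv.norm_map e.conjStarAlgEquiv (π.extend a)

/-- If `G` has an irreducible representation `π` of dimension `n₂ > n₁`, some element of `ℂG` is
killed by all representations of dimension at most `n₁`, but not by `π`. -/
theorem exists_extend_ne_zero_of_isIrreducible {n₁ n₂ : ℕ} (hn : n₁ < n₂)
    {π : UnitaryRep G (EuclideanSpace ℂ (Fin n₂))} (hπ : π.IsIrreducible) :
    ∃ c : MonoidAlgebra ℂ G, π.extend c ≠ 0 ∧
      ∀ k ≤ n₁, ∀ σ : UnitaryRep G (EuclideanSpace ℂ (Fin k)), σ.extend c = 0 := by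
  obtain ⟨y, x, z, h⟩ := exists_capelli_matrix_ne_zero ℂ (m := n₁ * n₁ + 1) (n := n₂)
    (by nlinarith) (by omega)
  let Φ := Matrix.toEuclideanCLM (n := Fin n₂) (𝕜 := ℂ)
  choose r hr using extend_surjective_of_isIrreducible hπ
  refine ⟨capelli (r ∘ Φ ∘ y) (r ∘ Φ ∘ x) (r ∘ Φ ∘ z), ?_, fun k hk σ => ?_⟩
  · have h1 := map_capelli π.extend (r ∘ Φ ∘ y) (r ∘ Φ ∘ x) (r ∘ Φ ∘ z)
    have h2 := map_capelli Φ y x z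
    have h3 : ∀ w : Fin (n₁ * n₁ + 1) → Matrix (Fin n₂) (Fin n₂) ℂ,
        π.extend ∘ r ∘ Φ ∘ w = Φ ∘ w := fun w => funext fun i => hr _
    rw [h3, h3, h3, ← h2] at h1
    intro h0
    refine h (Φ.injective ?_)
    rw [map_zero]
    exact h1.symm.trans h0
  · have h1 := map_capelli σ.extend (r ∘ Φ ∘ y) (r ∘ Φ ∘ x) (r ∘ Φ ∘ z)
    let Ψ := Matrix.toEuclideanCLM (n := Fin k) (𝕜 := ℂ)
    have : FiniteDimensional ℂ (EuclideanSpace ℂ (Fin k) →L[ℂ] EuclideanSpace ℂ (Fin k)) :=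
      Module.Finite.equiv Ψ.toAlgEquiv.toLinearEquiv
    refine h1.trans (capelli_eq_zero_of_finrank_lt (K := ℂ) ?_ _ _ _)
    rw [← Ψ.toAlgEquiv.toLinearEquiv.finrank_eq]
    simp only [Module.finrank_matrix, Fintype.card_fin, Module.finrank_self, mul_one]
    nlinarith

end UnitaryRep

theorem corollary5p2 {G : Type u} [Group G] (n₁ n₂ : ℕ) (hn : n₁ < n₂)
    (hG : ∃ π : UnitaryRep G (EuclideanSpace ℂ (Fin n₂)), π.IsIrreducible)
    (ε : ℝ) (hε : 0 < ε) :
    ∃ a : MonoidAlgebra ℂ G,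
      fullGroupNorm a = 1 ∧
      matrixSeminorm n₁ a ≤ ε ∧
      matrixSeminorm n₂ a > fullGroupNorm a - ε := by
  obtain ⟨π, hπ⟩ := hG
  obtain ⟨c, hc, hc0⟩ := UnitaryRep.exists_extend_ne_zero_of_isIrreducible hn hπ
  set t : ℝ := ‖star (π.extend c) * π.extend c‖ with ht
  have ht0 : 0 < t := by
    rw [ht, CStarRing.norm_star_mul_self]
    exact mul_pos (norm_pos_iff.2 hc) (norm_pos_iff.2 hc)
  set b : MonoidAlgebra ℂ G := ((t⁻¹ : ℝ) : ℂ) • (c.involution * c) with hb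
  obtain ⟨p, hp0, hpR, hp1, hp1'⟩ :=
    exists_polynomial_bounded_by_one (b.coeff.sum fun _ z => ‖z‖)
  set a : MonoidAlgebra ℂ G := aeval b (p.map (algebraMap ℝ ℂ)) with ha
  have hπ1 : 1 ≤ ‖π.extend a‖ := by
    rw [ha, UnitaryRep.extend_aeval_map]
    refine one_le_norm_aeval_of_isSelfAdjoint ?_ ?_ hp1 hp1'
    · rw [hb, map_smul, map_mul, UnitaryRep.extend_involution]
      exact .smul (Complex.conj_ofReal _) (.star_mul_self _)
    · rw [hb, map_smul, map_mul, UnitaryRep.extend_involution, norm_smul, ← ht, Complex.norm_real,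
        norm_inv, Real.norm_of_nonneg ht0.le, inv_mul_cancel₀ ht0.ne']
  have hfull : fullGroupNorm a = 1 := by
    refine le_antisymm (Real.sSup_le ?_ zero_le_one) ?_
    · rintro r ⟨H, _, _, _, τ, rfl⟩
      rw [ha, UnitaryRep.extend_aeval_map]
      refine norm_aeval_le_of_isSelfAdjoint ?_ p fun x hx => hpR x (hx.trans (τ.norm_extend_le b))
      rw [hb, map_smul, map_mul, UnitaryRep.extend_involution]
      exact .smul (Complex.conj_ofReal _) (.star_mul_self _)
    -- `fullGroupNorm` only sees spaces in the universe of `G`, so `π` is moved there.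
    · let e := LinearIsometryEquiv.piLpCongrLeft 2 ℂ ℂ (Equiv.ulift.{u} (α := Fin n₂)).symm
      refine hπ1.trans (le_csSup (fullGroupNorm_bddAbove a) ?_)
      exact ⟨EuclideanSpace ℂ (ULift.{u} (Fin n₂)), _, _, inferInstance, π.conj e,
        (π.norm_extend_conj e a).symm⟩
  refine ⟨a, hfull, Real.sSup_le ?_ hε.le, ?_⟩
  · rintro r ⟨k, hk, σ, rfl⟩
    have hσ : σ.extend b = 0 := by
      rw [hb, map_smul, map_mul, hc0 k hk σ, mul_zero, smul_zero]
    rw [ha, UnitaryRep.extend_aeval_map, hσ, ← coeff_zero_eq_aeval_zero', coeff_zero_eq_eval_zero,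
      hp0, map_zero, norm_zero]
    exact hε.le
  · have : 1 ≤ matrixSeminorm n₂ a :=
      hπ1.trans (le_csSup (matrixSeminorm_bddAbove n₂ a) ⟨n₂, le_rfl, π, rfl⟩)
    rw [hfull]
    linarith
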